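/- Let $r \ge 2$ be an integer, and let $(b^{(r)}_n)_{n\ge 0}$ be the generalized Baum–Sweet sequence: $b^{(r)}_n = 1$ if every block of $0$'s (maximal run of consecutive $0$'s) in the binary expansion of $n$ has length divisible by $r$, and $b^{(r)}_n = 0$ otherwise, with $b^{(r)}_0 = 1$. Let $(l^{(r)}_n)_{n \ge 0}$ be the characteristic sequence of $1$'s of this sequence, that is, the increasing sequence with $\{l^{(r)}_n : n \ge 0\} = \{m \ge 0 : b^{(r)}_m = 1\}$. Then for every integer $k \ge 2$ the sequence $(l^{(r)}_n)_{n\ge 0}$ is not $k$-regular. Here a sequence $(u_n)_{n\ge0}$ of integers is called $k$-regular if there are finitely many integer sequences $(s^{(1)}_n)_{n\ge0}, \dots, (s^{(m)}_n)_{n\ge0}$ such that for all $i \ge 0$ and $0 \le j < k^i$ there are $a_1,\dots,a_m \in \mathbb{Z}$ with $u_{k^i n + j} = \sum_{t=1}^m a_t s^{(t)}_n$ for all $n \ge 0$. -/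

import Mathlib

/-- The `k`-kernel of a sequence `u`: the set of the subsequences `(u (k ^ i * n + j))ₙ` with
`i ∈ ℕ` and `0 ≤ j < k ^ i`. -/
def kKernel {M : Type*} (k : ℕ) (u : ℕ → M) : Set (ℕ → M) :=
  {v | ∃ i j : ℕ, j < k ^ i ∧ v = fun n => u (k ^ i * n + j)}

/-- A sequence with values in a `ℤ`-module `M` is `k`-regular if there are finitely many sequences
`s 0, …, s (m - 1)` in `M` such that every element of the `k`-kernel is a `ℤ`-linear combination
of them. -/
def IsKRegular {M : Type*} [AddCommGroup M] (k : ℕ) (u : ℕ → M) : Prop :=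
  ∃ (m : ℕ) (s : Fin m → ℕ → M), ∀ v ∈ kKernel k u,
    ∃ a : Fin m → ℤ, ∀ n : ℕ, v n = ∑ t : Fin m, a t • s t n

/-- The binary digits of `n` at the positions `i, …, i + len - 1` (position `0` is the least
significant digit) form a block of `0`'s, that is, a nonempty maximal run of consecutive `0`'s in
the binary expansion of `n`. As the leading digit of a positive `n` is `1`, a maximal run of `0`'s
is always followed by a digit `1` at position `i + len`; it is preceded by a `1` at position
`i - 1` unless `i = 0`. The number `0` has the empty expansion, hence no blocks. -/
def IsZeroBlock (n i len : ℕ) : Prop :=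
  0 < len ∧ (∀ j, i ≤ j → j < i + len → n.testBit j = false) ∧
    n.testBit (i + len) = true ∧ (i = 0 ∨ n.testBit (i - 1) = true)

open Classical in
/-- The generalized Baum–Sweet sequence: the `n`-th term is `1` if all blocks of `0`'s in the binary
expansion of `n` have length divisible by `r`, and `0` otherwise; the term of index `0` is `1`. -/
noncomputable def baumSweet (r n : ℕ) : ℕ :=
  if ∀ i len : ℕ, IsZeroBlock n i len → r ∣ len then 1 else 0

/-- The characteristic sequence of `1`'s of the generalized Baum–Sweet sequence: the increasing
enumeration of `{m | baumSweet r m = 1}`. -/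
noncomputable def baumSweetOnes (r : ℕ) : ℕ → ℕ :=
  Nat.nth fun m => baumSweet r m = 1

theorem baumSweet_zero (r : ℕ) : baumSweet r 0 = 1 := by
  simp [baumSweet, IsZeroBlock]

theorem baumSweet_two_pow_sub_one (r j : ℕ) : baumSweet r (2 ^ j - 1) = 1 := by
  unfold baumSweet
  refine if_pos ?_
  rintro i len ⟨hl, h0, h1, -⟩
  have h := h0 i le_rfl (by omega)
  simp only [Nat.testBit_two_pow_sub_one, decide_eq_false_iff_not, decide_eq_true_eq] at h h1
  omega

theorem infinite_setOf_baumSweet_eq_one (r : ℕ) : {m | baumSweet r m = 1}.Infinite := by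
  refine Set.infinite_of_not_bddAbove ?_
  rintro ⟨B, hB⟩
  have h : 2 ^ (B + 1) - 1 ≤ B := hB (baumSweet_two_pow_sub_one r (B + 1))
  have := Nat.lt_two_pow_self (n := B + 1)
  omega

/-- The sequence `baumSweetOnes r` is strictly increasing, -/
theorem baumSweetOnes_strictMono (r : ℕ) : StrictMono (baumSweetOnes r) :=
  Nat.nth_strictMono (infinite_setOf_baumSweet_eq_one r)

/-- and its terms are exactly the indices at which the sequence `baumSweet r` is `1`. -/
theorem range_baumSweetOnes (r : ℕ) :
    Set.range (baumSweetOnes r) = {m | baumSweet r m = 1} :=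
  Nat.range_nth_of_infinite (infinite_setOf_baumSweet_eq_one r)

/-! Reduce modulo 2 and look at the frequency of odd terms. If the sequence of ones were
`k`-regular, its parity indicator would have a finite `k`-kernel, and any mean of such an indicator
along the powers of `k` is rational (`exists_rat_eq_mean_of_finite_kKernel`): averaging over blocks
acts on a finite-dimensional rational space, so the means satisfy a linear recurrence over ℚ.

The mean exists but is irrational. Let `P X` count the ones of the Baum–Sweet sequence below `X`.
Appending a binary digit 1, or `r` zeros, preserves the value of the sequence, so the odd ones below
`X` number `P (X / 2)` and the even ones `P (X / 2 ^ r)` up to an error of 1. This recurrence forces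
`P (X / 2) / P X` to tend to the root `p` in (0, 1) of `p + p ^ r = 1`
(`tendsto_div_of_recurrence`), and that root is irrational by the rational root theorem. -/

/-! ### Means of sequences with finite `k`-kernel are rational. -/

section RationalLimit

open Polynomial Filter Topology

/-- The shift operator on rational sequences. -/
def ratShift : Module.End ℚ (ℕ → ℚ) := LinearMap.funLeft ℚ ℚ (· + 1)

theorem tendsto_aeval_ratShift (p : ℚ[X]) (x : ℕ → ℚ) (d : ℝ)
    (h : Tendsto (fun i => (x i : ℝ)) atTop (𝓝 d)) :
    Tendsto (fun i => (aeval ratShift p x i : ℝ)) atTop (𝓝 ((p.eval 1 : ℚ) * d)) := by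
  induction p using Polynomial.induction_on' with
  | add p q hp hq =>
    simp only [map_add, LinearMap.add_apply, Pi.add_apply, Rat.cast_add, eval_add, add_mul]
    exact hp.add hq
  | monomial n a =>
    have key : ∀ (n i : ℕ), (ratShift ^ n) x i = x (i + n) := by
      intro n
      induction n with
      | zero => simp
      | succ n ih =>
        intro i
        rw [pow_succ', Module.End.mul_apply]
        change (ratShift ^ n) x (i + 1) = _
        rw [ih, add_right_comm, add_assoc]
    simp only [aeval_monomial, Module.End.mul_apply, Module.algebraMap_end_apply, Pi.smul_apply,
      key, smul_eq_mul, Rat.cast_mul, eval_monomial, one_pow, mul_one]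
    exact ((tendsto_add_atTop_iff_nat n).2 h).const_mul _

/-- The limit of a convergent rational sequence satisfying a linear recurrence is rational. -/
theorem exists_rat_eq_of_aeval_ratShift_eq_zero (n : ℕ) (p : ℚ[X]) (hn : p.natDegree ≤ n)
    (hp : p ≠ 0) (x : ℕ → ℚ) (d : ℝ) (h : Tendsto (fun i => (x i : ℝ)) atTop (𝓝 d))
    (h0 : aeval ratShift p x = 0) : ∃ q : ℚ, (q : ℝ) = d := by
  induction n generalizing p with
  | zero =>
    obtain ⟨c, rfl⟩ := natDegree_eq_zero.1 (Nat.le_zero.1 hn)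
    have hlim := tendsto_aeval_ratShift (C c) x d h
    simp only [h0, Pi.zero_apply, Rat.cast_zero, eval_C] at hlim
    have := tendsto_nhds_unique hlim tendsto_const_nhds
    rcases mul_eq_zero.1 this with h1 | h1
    · simp_all
    · exact ⟨0, by simp [h1]⟩
  | succ n ih =>
    -- A root at 1 is split off as `p = (X - 1) * g`; then `g` applied to `x` is constant, equal to
    -- `g(1) * d`. Either this gives `d`, or `g(1) = 0` and `g` is an annihilator of smaller degree.
    by_cases h1 : p.eval 1 = 0
    · obtain ⟨g, rfl⟩ := dvd_iff_isRoot.2 h1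
      have hg : g ≠ 0 := right_ne_zero_of_mul hp
      have hstep : ∀ i, aeval ratShift g x (i + 1) = aeval ratShift g x i := by
        intro i
        have := congrFun h0 i
        simp only [map_mul, Module.End.mul_apply, map_sub, aeval_X, map_one,
          LinearMap.sub_apply, Module.End.one_apply, Pi.sub_apply, Pi.zero_apply] at this
        exact sub_eq_zero.1 this
      have hconst : ∀ i, aeval ratShift g x i = aeval ratShift g x 0 := by
        intro i
        induction i with
        | zero => rfl
        | succ i ih => rw [hstep, ih]
      have hlim := tendsto_aeval_ratShift g x d h
      simp only [hconst] at hlim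
      have heq := tendsto_nhds_unique hlim tendsto_const_nhds
      by_cases hg1 : g.eval 1 = 0
      · refine ih g ?_ hg ?_
        · rw [natDegree_mul (X_sub_C_ne_zero 1) hg, natDegree_X_sub_C] at hn
          omega
        · rw [hg1, Rat.cast_zero, zero_mul] at heq
          funext i
          rw [hconst]
          exact_mod_cast heq.symm
      · refine ⟨aeval ratShift g x 0 / g.eval 1, ?_⟩
        have : ((g.eval 1 : ℚ) : ℝ) ≠ 0 := by exact_mod_cast hg1
        rw [Rat.cast_div, ← heq]
        field_simp
    · have hlim := tendsto_aeval_ratShift p x d h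
      simp only [h0, Pi.zero_apply, Rat.cast_zero] at hlim
      have heq := tendsto_nhds_unique hlim tendsto_const_nhds
      rcases mul_eq_zero.1 heq with h2 | h2
      · exact absurd (by exact_mod_cast h2) h1
      · exact ⟨0, by simp [h2]⟩

/-- The operator sending `v` to the sums of `v` over the consecutive intervals of length `k`. -/
def sumBlocks (k : ℕ) : Module.End ℚ (ℕ → ℚ) :=
  ∑ j ∈ Finset.range k, LinearMap.funLeft ℚ ℚ (fun n => k * n + j)

theorem sumBlocks_apply (k : ℕ) (v : ℕ → ℚ) (n : ℕ) :
    sumBlocks k v n = ∑ j ∈ Finset.range k, v (k * n + j) := by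
  simp [sumBlocks, LinearMap.sum_apply, LinearMap.funLeft]

theorem sum_range_sumBlocks (k : ℕ) (v : ℕ → ℚ) (N : ℕ) :
    ∑ n ∈ Finset.range N, sumBlocks k v n = ∑ n ∈ Finset.range (k * N), v n := by
  induction N with
  | zero => simp
  | succ N ih =>
    rw [Finset.sum_range_succ, ih, sumBlocks_apply, Nat.mul_succ, Finset.sum_range_add]

/-- Turns partial sums up to powers of `k` into iterates of one linear operator. -/
theorem sumBlocks_pow_apply_zero (k : ℕ) (v : ℕ → ℚ) (i : ℕ) :
    (sumBlocks k ^ i) v 0 = ∑ n ∈ Finset.range (k ^ i), v n := by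
  induction i generalizing v with
  | zero => simp
  | succ i ih =>
    rw [pow_succ, Module.End.mul_apply, ih, sum_range_sumBlocks, ← pow_succ']

/-- If a rational sequence with finite `k`-kernel has a mean value along the powers of `k`, then
this mean value is rational. -/
theorem exists_rat_eq_mean_of_finite_kKernel {k : ℕ} (u : ℕ → ℚ)
    (hu : (kKernel k u).Finite) (d : ℝ)
    (h : Tendsto (fun i => (((∑ n ∈ Finset.range (k ^ i), u n) / k ^ i : ℚ) : ℝ)) atTop (𝓝 d)) :
    ∃ q : ℚ, (q : ℝ) = d := by
  have hmem : u ∈ kKernel k u := ⟨0, 0, by simp, by simp⟩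
  let W := Submodule.span ℚ (kKernel k u)
  have : FiniteDimensional ℚ W := FiniteDimensional.span_of_finite ℚ hu
  -- The kernel is closed under passing to residue classes modulo `k`, so its span is stable under
  -- block averaging.
  have hW : ∀ w ∈ W, ((k : ℚ)⁻¹ • sumBlocks k) w ∈ W := by
    intro w hw
    rw [LinearMap.smul_apply]
    refine W.smul_mem _ ?_
    induction hw using Submodule.span_induction with
    | mem w hw =>
      have : sumBlocks k w = ∑ j ∈ Finset.range k, fun n => w (k * n + j) := by
        funext n
        simp [sumBlocks_apply]
      rw [this]
      refine W.sum_mem fun j hj => Submodule.subset_span ?_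
      obtain ⟨i, l, hl, rfl⟩ := hw
      refine ⟨i + 1, k ^ i * j + l, ?_, ?_⟩
      · have hj' : j + 1 ≤ k := Finset.mem_range.1 hj
        calc k ^ i * j + l < k ^ i * (j + 1) := by rw [mul_add]; omega
          _ ≤ k ^ i * k := Nat.mul_le_mul_left _ hj'
          _ = k ^ (i + 1) := (pow_succ _ _).symm
      · funext n
        change u (k ^ i * (k * n + j) + l) = u (k ^ (i + 1) * n + (k ^ i * j + l))
        congr 1
        ring
    | zero => simp
    | add x y _ _ hx hy => rw [map_add]; exact W.add_mem hx hy
    | smul a x _ hx => rw [map_smul]; exact W.smul_mem _ hx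
  let T : Module.End ℚ W := ((k : ℚ)⁻¹ • sumBlocks k).restrict hW
  obtain ⟨p, hp, hp0⟩ := LinearMap.exists_monic_and_aeval_eq_zero ℚ T
  -- the sequence of the means attached to an element of `W`
  let Φ : W →ₗ[ℚ] (ℕ → ℚ) :=
    LinearMap.pi fun i => (LinearMap.proj 0 ∘ₗ W.subtype) ∘ₗ (T ^ i)
  have hΦ : ∀ w, Φ (T w) = ratShift (Φ w) := by
    intro w
    funext i
    change ((T ^ i) (T w) : ℕ → ℚ) 0 = ((T ^ (i + 1)) w : ℕ → ℚ) 0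
    rw [pow_succ, Module.End.mul_apply]
  have hΦp : ∀ (g : ℚ[X]) w, Φ (aeval T g w) = aeval ratShift g (Φ w) := by
    intro g
    induction g using Polynomial.induction_on' with
    | add f g hf hg =>
      intro w
      simp [hf, hg]
    | monomial n a =>
      intro w
      simp only [aeval_monomial, Module.End.mul_apply, Module.algebraMap_end_apply, map_smul]
      congr 1
      induction n generalizing w with
      | zero => simp
      | succ n ih => rw [pow_succ, Module.End.mul_apply, ih, hΦ, pow_succ, Module.End.mul_apply]
  let w : W := ⟨u, Submodule.subset_span hmem⟩
  refine exists_rat_eq_of_aeval_ratShift_eq_zero _ p le_rfl hp.ne_zero (Φ w) d ?_ ?_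
  · convert h using 3 with i
    have hTi : ∀ i, ((T ^ i) w : ℕ → ℚ) = (((k : ℚ)⁻¹ • sumBlocks k) ^ i) u := by
      intro i
      induction i with
      | zero => rfl
      | succ i ih =>
        rw [pow_succ', Module.End.mul_apply, pow_succ', Module.End.mul_apply, ← ih]
        rfl
    change ((T ^ i) w : ℕ → ℚ) 0 = _
    rw [hTi, _root_.smul_pow, LinearMap.smul_apply, Pi.smul_apply, sumBlocks_pow_apply_zero, smul_eq_mul,
      inv_pow, div_eq_inv_mul]
  · rw [← hΦp, hp0, LinearMap.zero_apply, map_zero]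

/-- The indicator sequence of the odd terms of a `k`-regular integer sequence has finite
`k`-kernel. -/
theorem IsKRegular.finite_kKernel_odd {k : ℕ} {u : ℕ → ℤ} (h : IsKRegular k u) :
    (kKernel k fun n => if Odd (u n) then (1 : ℚ) else 0).Finite := by
  obtain ⟨m, s, hs⟩ := h
  -- Parity sees the coefficients only modulo 2, leaving at most `2 ^ m` kernel elements.
  refine (Set.finite_range fun (a : Fin m → ZMod 2) (n : ℕ) =>
    if ∑ t, a t * (s t n : ZMod 2) = 1 then (1 : ℚ) else 0).subset ?_
  rintro _ ⟨i, j, hj, rfl⟩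
  obtain ⟨a, ha⟩ := hs _ ⟨i, j, hj, rfl⟩
  refine ⟨fun t => (a t : ZMod 2), ?_⟩
  funext n
  have h1 : ∑ t, (a t : ZMod 2) * (s t n : ZMod 2) = (u (k ^ i * n + j) : ZMod 2) := by
    rw [show u (k ^ i * n + j) = _ from ha n]
    simp
  simp only [h1, ZMod.intCast_eq_one_iff_odd]

end RationalLimit

/-! ### Asymptotics of the recurrence under halving. -/

section Frequency

open Filter Topology

theorem tendsto_div_two_pow_atTop (j : ℕ) : Tendsto (fun X : ℕ => X / 2 ^ j) atTop atTop :=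
  Nat.tendsto_div_const_atTop (by positivity)

theorem Ultrafilter.exists_tendsto_of_abs_le {y : ℕ → ℝ} (hb : ∀ X, |y X| ≤ 1)
    (U : Ultrafilter ℕ) : ∃ x, Tendsto y U (𝓝 x) := by
  obtain ⟨x, -, hx⟩ := (isCompact_Icc (a := (-1 : ℝ)) (b := 1)).ultrafilter_le_nhds (U.map y)
    (le_principal_iff.2 (Filter.univ_mem' (f := (U : Filter ℕ)) fun X => abs_le.1 (hb X)))
  exact ⟨x, hx⟩

/-- A bound for all cluster points of a sequence which is asymptotically an average of its
rescalings, and whose averages over `r` consecutive rescalings converge. -/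
theorem cluster_point_le_of_asymptotic_average {y : ℕ → ℝ} (hb : ∀ X, |y X| ≤ 1) {p q c : ℝ} (hp : 0 < p)
    (hq : 0 < q) (hpq : p + q = 1) (r : ℕ)
    (h1 : Tendsto (fun X => y X - p * y (X / 2) - q * y (X / 2 ^ r)) atTop (𝓝 0))
    (h2 : Tendsto (fun X => p * y X + (1 - p) * ∑ j ∈ Finset.range r, y (X / 2 ^ j))
      atTop (𝓝 c)) :
    ∀ (U : Ultrafilter ℕ) (x : ℝ), (U : Filter ℕ) ≤ atTop → Tendsto y U (𝓝 x) →
      x ≤ c / (p + (1 - p) * r) := by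
  have hcl : IsCompact {x | MapClusterPt x atTop y} := by
    refine isCompact_Icc.of_isClosed_subset (s := Set.Icc (-1 : ℝ) 1) isClosed_setOfPred_clusterPt ?_
    intro x hx
    obtain ⟨U, -, hU⟩ := mapClusterPt_iff_ultrafilter.1 hx
    exact isClosed_Icc.mem_of_tendsto hU (Eventually.of_forall fun X => abs_le.1 (hb X))
  have hne : {x | MapClusterPt x atTop y}.Nonempty := by
    obtain ⟨x, hx⟩ := Ultrafilter.exists_tendsto_of_abs_le hb (Ultrafilter.of atTop)
    exact ⟨x, mapClusterPt_iff_ultrafilter.2 ⟨_, Ultrafilter.of_le _, hx⟩⟩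
  obtain ⟨S, hS, hmax⟩ := hcl.exists_isGreatest hne
  obtain ⟨U, hU, hUS⟩ := mapClusterPt_iff_ultrafilter.1 hS
  have hdiv : ∀ (j : ℕ) (W : Ultrafilter ℕ), (W : Filter ℕ) ≤ atTop →
      (W.map (fun X => X / 2 ^ j) : Filter ℕ) ≤ atTop :=
    fun j W hW => (tendsto_div_two_pow_atTop j).mono_left hW
  have hle : ∀ (W : Ultrafilter ℕ), (W : Filter ℕ) ≤ atTop → ∀ x, Tendsto y W (𝓝 x) → x ≤ S :=
    fun W hW x hx => hmax (mapClusterPt_iff_ultrafilter.2 ⟨W, hW, hx⟩)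
  have hstep : ∀ (W : Ultrafilter ℕ), (W : Filter ℕ) ≤ atTop → Tendsto y W (𝓝 S) →
      Tendsto (fun X => y (X / 2)) W (𝓝 S) := by
    intro W hW hWS
    obtain ⟨x₁, hx₁⟩ :=
      Ultrafilter.exists_tendsto_of_abs_le hb (W.map (fun X => X / 2 ^ 1))
    obtain ⟨x₂, hx₂⟩ :=
      Ultrafilter.exists_tendsto_of_abs_le hb (W.map (fun X => X / 2 ^ r))
    have hle₁ := hle _ (hdiv 1 W hW) x₁ hx₁
    have hle₂ := hle _ (hdiv r W hW) x₂ hx₂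
    have hx₁' : Tendsto (fun X => y (X / 2)) W (𝓝 x₁) := by
      simpa [Function.comp_def] using tendsto_map'_iff.1 hx₁
    have hx₂' : Tendsto (fun X => y (X / 2 ^ r)) W (𝓝 x₂) := tendsto_map'_iff.1 hx₂
    have heq := tendsto_nhds_unique (h1.mono_left hW)
      ((hWS.sub (hx₁'.const_mul p)).sub (hx₂'.const_mul q))
    -- `S` is the weighted average of `x₁` and `x₂`, neither of which exceeds the largest cluster
    -- point `S`; positive weights force equality.
    have : x₁ = S := by
      have hqS : q = 1 - p := by linarith
      have : p * (S - x₁) + q * (S - x₂) = 0 := by rw [hqS] at heq ⊢; linarith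
      have h3 : 0 ≤ q * (S - x₂) := mul_nonneg hq.le (by linarith)
      have h4 : p * (S - x₁) ≤ 0 := by linarith
      have := nonpos_of_mul_nonpos_right h4 hp
      linarith
    rwa [this] at hx₁'
  have hall : ∀ j, Tendsto (fun X => y (X / 2 ^ j)) U (𝓝 S) := by
    intro j
    induction j with
    | zero => simpa using hUS
    | succ j ih =>
      have := hstep (U.map (fun X => X / 2 ^ j)) (hdiv j U hU) (tendsto_map'_iff.2 ih)
      simpa [Function.comp_def, Nat.div_div_eq_div_mul, pow_succ] using tendsto_map'_iff.1 this
  have hfin : Tendsto (fun X => p * y X + (1 - p) * ∑ j ∈ Finset.range r, y (X / 2 ^ j)) U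
      (𝓝 (p * S + (1 - p) * ∑ _j ∈ Finset.range r, S)) :=
    (hUS.const_mul p).add ((tendsto_finsetSum _ fun j _ => hall j).const_mul _)
  have heq := tendsto_nhds_unique hfin (h2.mono_left hU)
  have hκ : 0 < p + (1 - p) * r := by
    have : 0 ≤ (1 - p) * r := mul_nonneg (by linarith) (Nat.cast_nonneg r)
    linarith
  intro W x hW hx
  refine (hle W hW x hx).trans ?_
  rw [le_div_iff₀ hκ, ← heq]
  simp only [Finset.sum_const, Finset.card_range, nsmul_eq_mul]
  apply le_of_eq
  ring

/-- The upper bound on cluster points, applied to `y` and to `-y`, pins every cluster point to the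
same value. -/
theorem tendsto_of_asymptotic_average {y : ℕ → ℝ} (hb : ∀ X, |y X| ≤ 1) {p q : ℝ} (hp : 0 < p)
    (hq : 0 < q) (hpq : p + q = 1) (r : ℕ)
    (h1 : Tendsto (fun X => y X - p * y (X / 2) - q * y (X / 2 ^ r)) atTop (𝓝 0))
    (h2 : Tendsto (fun X => p * y X + (1 - p) * ∑ j ∈ Finset.range r, y (X / 2 ^ j))
      atTop (𝓝 1)) :
    Tendsto y atTop (𝓝 (1 / (p + (1 - p) * r))) := by
  rw [tendsto_iff_ultrafilter]
  intro U hU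
  obtain ⟨x, hx⟩ := Ultrafilter.exists_tendsto_of_abs_le hb U
  have hup := cluster_point_le_of_asymptotic_average hb hp hq hpq r h1 h2 U x hU hx
  have hlo := cluster_point_le_of_asymptotic_average (y := fun X => -y X) (c := -1)
    (fun X => by simpa using hb X) hp hq hpq r
    (by
      have := h1.neg
      rw [neg_zero] at this
      exact this.congr fun X => by ring)
    (by
      refine h2.neg.congr fun X => ?_
      rw [Finset.sum_neg_distrib]
      ring) U (-x) hU hx.neg
  have : x = 1 / (p + (1 - p) * r) := by
    rw [neg_div] at hlo
    linarith
  rwa [← this]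

/-- A nonnegative sequence tending to infinity with `P X = P (X / 2) + P (X / 2 ^ r) + O(1)` satisfies
`P (X / 2) ~ p * P X`, where `p + p ^ r = 1`. -/
theorem tendsto_div_of_recurrence {P : ℕ → ℝ} {r : ℕ} {p C : ℝ} (hp : 0 < p) (hp1 : p < 1)
    (hpr : p + p ^ r = 1) (hr : 1 ≤ r) (hP0 : ∀ X, 0 ≤ P X) (hP : Tendsto P atTop atTop)
    (hrec : ∀ X, |P X - P (X / 2) - P (X / 2 ^ r)| ≤ C) :
    Tendsto (fun X => P (X / 2) / P X) atTop (𝓝 p) := by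
  -- `V` is the combination that turns the recurrence into `V (X / 2) = p * V X + O(1)`. Since `P X`
  -- has total coefficient 1 in it, `V` also dominates `P`.
  set V : ℕ → ℝ := fun X =>
    p * P X + (1 - p) * ∑ j ∈ Finset.range r, P (X / 2 ^ j) / p ^ j with hV
  have hVP : ∀ X, P X ≤ V X := by
    intro X
    have : P X ≤ ∑ j ∈ Finset.range r, P (X / 2 ^ j) / p ^ j := by
      have := Finset.single_le_sum (f := fun j => P (X / 2 ^ j) / p ^ j) (s := Finset.range r)
        (fun j _ => div_nonneg (hP0 _) (by positivity)) (Finset.mem_range.2 hr)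
      simpa using this
    have := mul_le_mul_of_nonneg_left this (by linarith : 0 ≤ 1 - p)
    simp only [hV]
    linarith
  have hVtop : Tendsto V atTop atTop := tendsto_atTop_mono hVP hP
  have hVrec : ∀ X, V (X / 2) - p * V X = - (p * (P X - P (X / 2) - P (X / 2 ^ r))) := by
    intro X
    have hs : ∑ j ∈ Finset.range r, P (X / 2 / 2 ^ j) / p ^ j
        = p * (∑ j ∈ Finset.range r, P (X / 2 ^ j) / p ^ j + P (X / 2 ^ r) / p ^ r - P X) := by
      have h3 := Finset.sum_range_succ (fun j => P (X / 2 ^ j) / p ^ j) r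
      have h4 := Finset.sum_range_succ' (fun j => P (X / 2 ^ j) / p ^ j) r
      rw [h3] at h4
      rw [h4]
      simp only [pow_zero, Nat.div_one, div_one, add_sub_cancel_right, Finset.mul_sum]
      refine Finset.sum_congr rfl fun j _ => ?_
      rw [Nat.div_div_eq_div_mul, ← pow_succ', pow_succ p]
      field_simp
    have hpr' : (1 - p) * (P (X / 2 ^ r) / p ^ r) = P (X / 2 ^ r) := by
      rw [show 1 - p = p ^ r by linarith]
      field_simp
    simp only [hV]
    rw [hs]
    linear_combination p * hpr'
  have hquot : ∀ g : ℕ → ℝ, (∃ B, ∀ X, |g X| ≤ B) →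
      Tendsto (fun X => g X / V X) atTop (𝓝 0) := by
    rintro g ⟨B, hB⟩
    refine squeeze_zero_norm' (a := fun X => B / V X) ?_ (hVtop.const_div_atTop B)
    filter_upwards [hVtop.eventually_gt_atTop 0] with X hX
    rw [norm_div, Real.norm_eq_abs, Real.norm_eq_abs, abs_of_pos hX]
    gcongr
    exact hB X
  have hdiv : Tendsto (fun X : ℕ => X / 2) atTop atTop := by
    simpa using tendsto_div_two_pow_atTop 1
  have hV1 : Tendsto (fun X => V (X / 2) / V X) atTop (𝓝 p) := by
    have h0 := (hquot (fun X => V (X / 2) - p * V X) ⟨p * C, fun X => by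
      rw [hVrec, abs_neg, abs_mul, abs_of_pos hp]
      exact mul_le_mul_of_nonneg_left (hrec X) hp.le⟩).add_const p
    rw [zero_add] at h0
    refine h0.congr' ?_
    filter_upwards [hVtop.eventually_gt_atTop 0] with X hX
    field_simp
    ring
  have hVj : ∀ j, Tendsto (fun X => V (X / 2 ^ j) / V X) atTop (𝓝 (p ^ j)) := by
    intro j
    induction j with
    | zero =>
      simp only [pow_zero, Nat.div_one]
      refine tendsto_const_nhds.congr' ?_
      filter_upwards [hVtop.eventually_gt_atTop 0] with X hX
      rw [div_self hX.ne']
    | succ j ih =>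
      have h3 := (hV1.comp (tendsto_div_two_pow_atTop j)).mul ih
      rw [← pow_succ'] at h3
      refine h3.congr' ?_
      filter_upwards [(hVtop.comp (tendsto_div_two_pow_atTop j)).eventually_gt_atTop 0] with X hX
      simp only [Function.comp_apply] at hX ⊢
      rw [div_mul_div_cancel₀ hX.ne', Nat.div_div_eq_div_mul, ← pow_succ]
  set y : ℕ → ℝ := fun X => P X / V X with hy
  have hV0 : ∀ X, 0 ≤ V X := fun X => (hP0 X).trans (hVP X)
  have hb : ∀ X, |y X| ≤ 1 := by
    intro X
    rw [hy, abs_of_nonneg (div_nonneg (hP0 X) (hV0 X))]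
    exact div_le_one_of_le₀ (hVP X) (hV0 X)
  -- `P (X / 2 ^ j) / V X` is asymptotically `p ^ j * y (X / 2 ^ j)`
  have hPj : ∀ j, Tendsto (fun X => P (X / 2 ^ j) / V X - p ^ j * y (X / 2 ^ j)) atTop (𝓝 0) := by
    intro j
    have h3 : Tendsto (fun X => V (X / 2 ^ j) / V X - p ^ j) atTop (𝓝 0) := by
      simpa using (hVj j).sub_const (p ^ j)
    refine squeeze_zero_norm' (a := fun X => |V (X / 2 ^ j) / V X - p ^ j|) ?_
      (by simpa using h3.abs)
    filter_upwards [(hVtop.comp (tendsto_div_two_pow_atTop j)).eventually_gt_atTop 0] with X hX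
    simp only [Function.comp_apply] at hX
    have : P (X / 2 ^ j) / V X - p ^ j * y (X / 2 ^ j)
        = y (X / 2 ^ j) * (V (X / 2 ^ j) / V X - p ^ j) := by
      simp only [hy]
      field_simp
    rw [this, Real.norm_eq_abs, abs_mul]
    exact mul_le_of_le_one_left (abs_nonneg _) (hb _)
  -- `h1` is the recurrence for `P` divided by `V X`; `h2` is the definition of `V` divided by `V
  -- X`.
  have h1 : Tendsto (fun X => y X - p * y (X / 2) - p ^ r * y (X / 2 ^ r)) atTop (𝓝 0) := by
    have h3 := ((hquot _ ⟨C, hrec⟩).add (hPj 1)).add (hPj r)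
    simp only [add_zero, pow_one] at h3
    refine h3.congr fun X => ?_
    simp only [hy]
    ring
  have h2 : Tendsto (fun X => p * y X + (1 - p) * ∑ j ∈ Finset.range r, y (X / 2 ^ j))
      atTop (𝓝 1) := by
    have h3 : Tendsto (fun X => ∑ j ∈ Finset.range r,
        (P (X / 2 ^ j) / V X - p ^ j * y (X / 2 ^ j)) / p ^ j) atTop (𝓝 0) := by
      simpa using tendsto_finsetSum (Finset.range r) fun j _ => (hPj j).div_const (p ^ j)
    have h4 := (h3.const_mul (1 - p)).const_sub 1
    rw [mul_zero, sub_zero] at h4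
    refine h4.congr' ?_
    filter_upwards [hVtop.eventually_gt_atTop 0] with X hX
    have h5 : p * y X + (1 - p) * ∑ j ∈ Finset.range r, P (X / 2 ^ j) / p ^ j / V X = 1 := by
      rw [← Finset.sum_div]
      simp only [hy]
      rw [mul_div_assoc', mul_div_assoc', ← add_div, div_eq_one_iff_eq hX.ne']
    have h6 : ∑ j ∈ Finset.range r, (P (X / 2 ^ j) / V X - p ^ j * y (X / 2 ^ j)) / p ^ j
        = ∑ j ∈ Finset.range r, P (X / 2 ^ j) / p ^ j / V X
          - ∑ j ∈ Finset.range r, y (X / 2 ^ j) := by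
      rw [← Finset.sum_sub_distrib]
      refine Finset.sum_congr rfl fun j _ => ?_
      field_simp
    rw [h6]
    linear_combination -h5
  have hlim := tendsto_of_asymptotic_average hb hp (pow_pos hp r) hpr r h1 h2
  have hκ : (1 : ℝ) / (p + (1 - p) * r) ≠ 0 := by
    have : 0 ≤ (1 - p) * r := mul_nonneg (by linarith) (Nat.cast_nonneg r)
    exact one_div_ne_zero (by linarith)
  -- As `P = y * V` and `y` has a nonzero limit, the ratio of `P` inherits the limit of the ratio of
  -- `V`.
  have hfin := ((hlim.comp hdiv).mul hV1).div hlim hκ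
  rw [mul_div_cancel_left₀ _ hκ] at hfin
  refine hfin.congr' ?_
  filter_upwards [hVtop.eventually_gt_atTop 0, hP.eventually_gt_atTop 0,
    (hVtop.comp hdiv).eventually_gt_atTop 0] with X h3 h4 h5
  simp only [hy, Pi.div_apply, Function.comp_apply] at h5 ⊢
  field_simp

end Frequency

/-! ### Counting the ones of the Baum–Sweet sequence by parity. -/

section Counting

open Filter Topology

theorem baumSweet_eq_one_iff (r n : ℕ) :
    baumSweet r n = 1 ↔ ∀ i len : ℕ, IsZeroBlock n i len → r ∣ len := by
  simp [baumSweet]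

theorem isZeroBlock_two_mul_add_one_succ (m i len : ℕ) :
    IsZeroBlock (2 * m + 1) (i + 1) len ↔ IsZeroBlock m i len := by
  have hbit : ∀ j, (2 * m + 1).testBit (j + 1) = m.testBit j := by
    intro j
    rw [Nat.testBit_succ, show (2 * m + 1) / 2 = m by omega]
  have h0 : (2 * m + 1).testBit 0 = true := by simp
  unfold IsZeroBlock
  refine and_congr_right fun _ => and_congr ?_ (and_congr ?_ ?_)
  · constructor
    · intro h j h1 h2
      rw [← hbit]
      exact h _ (by omega) (by omega)
    · intro h j h1 h2
      obtain ⟨j, rfl⟩ : ∃ j', j = j' + 1 := ⟨j - 1, by omega⟩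
      rw [hbit]
      exact h _ (by omega) (by omega)
  · rw [add_right_comm, hbit]
  · cases i with
    | zero => simp [h0]
    | succ i => simp [hbit]

theorem not_isZeroBlock_zero_of_odd {n len : ℕ} (hn : n.testBit 0 = true) :
    ¬ IsZeroBlock n 0 len := by
  rintro ⟨h1, h2, -⟩
  have := h2 0 le_rfl (by omega)
  rw [hn] at this
  contradiction

theorem baumSweet_two_mul_add_one (r m : ℕ) :
    baumSweet r (2 * m + 1) = 1 ↔ baumSweet r m = 1 := by
  simp only [baumSweet_eq_one_iff]
  constructor
  · intro h i len hb
    exact h (i + 1) len ((isZeroBlock_two_mul_add_one_succ m i len).2 hb)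
  · intro h i len hb
    cases i with
    | zero => exact absurd hb (not_isZeroBlock_zero_of_odd (by simp))
    | succ i => exact h i len ((isZeroBlock_two_mul_add_one_succ m i len).1 hb)

theorem baumSweet_two_pow_mul_of_odd (r a : ℕ) {o : ℕ} (ho : Odd o) :
    baumSweet r (2 ^ a * o) = 1 ↔ r ∣ a ∧ baumSweet r o = 1 := by
  rcases Nat.eq_zero_or_pos a with rfl | ha
  · simp
  have ho0 : o.testBit 0 = true := by simpa [Nat.odd_iff] using ho
  have hlow : ∀ j, j < a → (2 ^ a * o).testBit j = false := by
    intro j hj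
    simp [Nat.testBit_two_pow_mul, hj]
  have hhigh : ∀ j, (2 ^ a * o).testBit (j + a) = o.testBit j := by
    intro j
    simp [Nat.testBit_two_pow_mul]
  have hmid : (2 ^ a * o).testBit a = true := by
    simpa [ho0] using hhigh 0
  simp only [baumSweet_eq_one_iff]
  constructor
  · intro h
    refine ⟨h 0 a ⟨ha, fun j _ hj => hlow j (by omega), by simpa using hmid, Or.inl rfl⟩, ?_⟩
    rintro i len hb
    rcases Nat.eq_zero_or_pos i with rfl | hi
    · exact absurd hb (not_isZeroBlock_zero_of_odd ho0)
    obtain ⟨h1, h2, h3, h4⟩ := hb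
    refine h (i + a) len ⟨h1, ?_, ?_, Or.inr ?_⟩
    · intro j hj1 hj2
      obtain ⟨j, rfl⟩ : ∃ j', j = j' + a := ⟨j - a, by omega⟩
      rw [hhigh]
      exact h2 j (by omega) (by omega)
    · rw [add_right_comm, hhigh]
      exact h3
    · rw [show i + a - 1 = i - 1 + a by omega, hhigh]
      exact h4.resolve_left hi.ne'
  · rintro ⟨hra, h⟩ i len ⟨h1, h2, h3, h4⟩
    rcases lt_trichotomy i a with hi | hi | hi
    -- A block starting among the trailing zeros must be the whole trailing block, of length `a`.
    · have hi0 : i = 0 := by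
        rcases h4 with h4 | h4
        · exact h4
        · rw [hlow _ (by omega)] at h4
          contradiction
      subst hi0
      have : len = a := by
        rw [zero_add] at h3 h2
        rcases lt_trichotomy len a with hl | hl | hl
        · rw [hlow _ hl] at h3
          contradiction
        · exact hl
        · rw [h2 a ha.le hl] at hmid
          contradiction
      rwa [this]
    · subst hi
      rw [h2 i le_rfl (by omega)] at hmid
      contradiction
    · obtain ⟨i, rfl⟩ : ∃ i', i = i' + a := ⟨i - a, by omega⟩
      refine h i len ⟨h1, fun j hj1 hj2 => ?_, ?_, Or.inr ?_⟩
      · rw [← hhigh]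
        exact h2 _ (by omega) (by omega)
      · rwa [add_right_comm, hhigh] at h3
      · rw [← hhigh, show i - 1 + a = i + a - 1 by omega]
        exact h4.resolve_left (by omega)

theorem baumSweet_two_pow_mul (r m : ℕ) :
    baumSweet r (2 ^ r * m) = 1 ↔ baumSweet r m = 1 := by
  rcases Nat.eq_zero_or_pos m with rfl | hm
  · simp
  obtain ⟨a, o, ho, rfl⟩ := Nat.exists_eq_two_pow_mul_odd hm.ne'
  rw [← mul_assoc, ← pow_add, baumSweet_two_pow_mul_of_odd _ _ ho,
    baumSweet_two_pow_mul_of_odd _ _ ho, Nat.dvd_add_right dvd_rfl]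

theorem two_pow_dvd_of_baumSweet_eq_one {r m : ℕ} (hm : Even m) (h : baumSweet r m = 1) :
    2 ^ r ∣ m := by
  rcases Nat.eq_zero_or_pos m with rfl | hm0
  · simp
  obtain ⟨a, o, ho, rfl⟩ := Nat.exists_eq_two_pow_mul_odd hm0.ne'
  have hra := ((baumSweet_two_pow_mul_of_odd r a ho).1 h).1
  have ha : a ≠ 0 := by
    rintro rfl
    rw [pow_zero, one_mul] at hm
    exact Nat.not_even_iff_odd.2 ho hm
  exact (pow_dvd_pow 2 (Nat.le_of_dvd (Nat.pos_of_ne_zero ha) hra)).mul_right o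

open Classical in
/-- The number of `m < X` at which the generalized Baum–Sweet sequence is `1`. -/
noncomputable def baumSweetCount (r X : ℕ) : ℕ := Nat.count (fun m => baumSweet r m = 1) X

open Classical in
theorem count_baumSweet_odd (r X : ℕ) :
    Nat.count (fun m => baumSweet r m = 1 ∧ Odd m) X = baumSweetCount r (X / 2) := by
  unfold baumSweetCount
  induction X with
  | zero => simp
  | succ X ih =>
    rw [Nat.count_succ, ih]
    rcases Nat.even_or_odd' X with ⟨y, rfl | rfl⟩
    · rw [show (2 * y + 1) / 2 = 2 * y / 2 by omega]
      simp
    · rw [show (2 * y + 1 + 1) / 2 = y + 1 by omega, show (2 * y + 1) / 2 = y by omega,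
        Nat.count_succ]
      simp [baumSweet_two_mul_add_one]

-- An even one has the form `2 ^ r * y` with `y` again a one. The argument on the right is the
-- ceiling of `X / 2 ^ r`, the number of `y` with `2 ^ r * y < X`.
open Classical in
theorem count_baumSweet_even {r : ℕ} (hr : 1 ≤ r) (X : ℕ) :
    Nat.count (fun m => baumSweet r m = 1 ∧ Even m) X
      = baumSweetCount r ((X + (2 ^ r - 1)) / 2 ^ r) := by
  unfold baumSweetCount
  have hpos : 0 < 2 ^ r := by positivity
  induction X with
  | zero => simp [Nat.div_eq_of_lt (Nat.sub_lt hpos one_pos)]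
  | succ X ih =>
    rw [Nat.count_succ, ih, show X + 1 + (2 ^ r - 1) = X + 2 ^ r by omega,
      Nat.add_div_right _ hpos]
    by_cases hX : 2 ^ r ∣ X
    · obtain ⟨y, rfl⟩ := hX
      have heven : Even (2 ^ r * y) := (even_two.pow_of_ne_zero (by omega)).mul_right y
      rw [Nat.mul_add_div hpos, Nat.div_eq_of_lt (Nat.sub_lt hpos one_pos),
        Nat.mul_div_cancel_left _ hpos, add_zero, Nat.count_succ]
      simp [baumSweet_two_pow_mul, heven]
    · have h1 : ¬ (baumSweet r X = 1 ∧ Even X) :=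
        fun h => hX (two_pow_dvd_of_baumSweet_eq_one h.2 h.1)
      have h2 : (X + (2 ^ r - 1)) / 2 ^ r = X / 2 ^ r + 1 := by
        have h3 : 0 < X % 2 ^ r := Nat.pos_of_ne_zero fun h => hX (Nat.dvd_of_mod_eq_zero h)
        have h4 := Nat.div_add_mod X (2 ^ r)
        have h5 := Nat.mod_lt X hpos
        refine Nat.div_eq_of_lt_le ?_ ?_
        · rw [add_mul, mul_comm]; omega
        · rw [add_mul, add_mul, mul_comm (X / 2 ^ r)]; omega
      rw [if_neg h1, h2, add_zero]

theorem baumSweetCount_mono (r : ℕ) : Monotone (baumSweetCount r) := by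
  classical
  exact Nat.count_monotone _

theorem baumSweetCount_recurrence {r : ℕ} (hr : 1 ≤ r) (X : ℕ) :
    baumSweetCount r (X / 2) + baumSweetCount r (X / 2 ^ r) ≤ baumSweetCount r X ∧
      baumSweetCount r X ≤ baumSweetCount r (X / 2) + baumSweetCount r (X / 2 ^ r) + 1 := by
  classical
  have hsum : baumSweetCount r X = baumSweetCount r (X / 2)
      + baumSweetCount r ((X + (2 ^ r - 1)) / 2 ^ r) := by
    rw [← count_baumSweet_odd, ← count_baumSweet_even hr, baumSweetCount]
    induction X with
    | zero => simp
    | succ X ih =>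
      simp only [Nat.count_succ, ih]
      by_cases h : Odd X
      · have h' := Nat.not_even_iff_odd.2 h
        simp only [h, h', and_true, and_false, if_false]
        omega
      · have h' := Nat.not_odd_iff_even.1 h
        simp only [h, h', and_true, and_false, if_false]
        omega
  have hpos : 0 < 2 ^ r := by positivity
  have h1 := baumSweetCount_mono r
    (Nat.div_le_div_right (c := 2 ^ r) (Nat.le_add_right X (2 ^ r - 1)))
  have h2 : (X + (2 ^ r - 1)) / 2 ^ r ≤ X / 2 ^ r + 1 := by
    rw [← Nat.add_div_right _ hpos]
    exact Nat.div_le_div_right (by omega)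
  have h3 := baumSweetCount_mono r h2
  have h4 : baumSweetCount r (X / 2 ^ r + 1) ≤ baumSweetCount r (X / 2 ^ r) + 1 := by
    unfold baumSweetCount
    rw [Nat.count_succ]
    split_ifs <;> omega
  omega

theorem baumSweetCount_baumSweetOnes (r N : ℕ) :
    baumSweetCount r (baumSweetOnes r N) = N := by
  classical
  exact Nat.count_nth_of_infinite (infinite_setOf_baumSweet_eq_one r) N

theorem tendsto_baumSweetCount (r : ℕ) : Tendsto (baumSweetCount r) atTop atTop :=
  tendsto_atTop_atTop_of_monotone (baumSweetCount_mono r) fun N =>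
    ⟨_, (baumSweetCount_baumSweetOnes r N).ge⟩

theorem sum_odd_baumSweetOnes (r N : ℕ) :
    ∑ n ∈ Finset.range N, (if Odd (baumSweetOnes r n : ℤ) then (1 : ℚ) else 0)
      = baumSweetCount r (baumSweetOnes r N / 2) := by
  classical
  rw [← count_baumSweet_odd, Nat.count_eq_card_filter_range, ← Finset.filter_filter]
  induction N with
  | zero =>
    have : baumSweetOnes r 0 = 0 := Nat.nth_zero_of_zero (baumSweet_zero r)
    simp [this]
  | succ N ih =>
    have hins := Nat.filter_range_nth_eq_insert_of_infinite
      (infinite_setOf_baumSweet_eq_one r) N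
    have hnot : baumSweetOnes r N ∉ ((Finset.range (baumSweetOnes r N)).filter
        fun m => baumSweet r m = 1).filter Odd := by simp
    rw [Finset.sum_range_succ, ih, baumSweetOnes, hins, Finset.filter_insert]
    rw [baumSweetOnes] at hnot
    simp only [Int.odd_coe_nat]
    split_ifs with h
    · rw [Finset.card_insert_of_notMem hnot]
      push_cast
      rfl
    · rw [add_zero]

theorem exists_irrational_add_pow_eq_one {r : ℕ} (hr : 1 < r) :
    ∃ p : ℝ, 0 < p ∧ p < 1 ∧ p + p ^ r = 1 ∧ Irrational p := by
  have hcont : ContinuousOn (fun x : ℝ => x + x ^ r) (Set.Icc 0 1) := by fun_prop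
  obtain ⟨p, ⟨h0, h1⟩, hp⟩ := intermediate_value_Icc zero_le_one hcont
    (show (1 : ℝ) ∈ Set.Icc _ _ by simp [show r ≠ 0 by omega])
  have hp : p + p ^ r = 1 := hp
  have hp0 : p ≠ 0 := by
    rintro rfl
    simp [show r ≠ 0 by omega] at hp
  have hp1 : p ≠ 1 := by
    rintro rfl
    norm_num at hp
  refine ⟨p, lt_of_le_of_ne h0 hp0.symm, lt_of_le_of_ne h1 hp1, hp, ?_⟩
  rintro ⟨q, rfl⟩
  have hq : q + q ^ r = 1 := by exact_mod_cast hp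
  -- `q` is a root of the monic integer polynomial `X ^ r + X - 1`, so it would be an integer
  -- strictly between 0 and 1.
  have hint : IsIntegral ℤ q := by
    refine ⟨Polynomial.X ^ r + (Polynomial.X - 1), ?_, ?_⟩
    · refine (Polynomial.monic_X_pow r).add_of_left ?_
      rw [Polynomial.degree_X_pow, ← Polynomial.C_1, Polynomial.degree_X_sub_C]
      exact_mod_cast hr
    · simp
      linarith
  obtain ⟨z, rfl⟩ := IsIntegrallyClosed.isIntegral_iff.1 hint
  have hz0 : (0 : ℝ) < z := lt_of_le_of_ne (by simpa using h0) (by simpa using hp0.symm)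
  have hz1 : (z : ℝ) < 1 := lt_of_le_of_ne (by simpa using h1) (by simpa using hp1)
  have hz0' : 0 < z := by exact_mod_cast hz0
  have hz1' : z < 1 := by exact_mod_cast hz1
  omega

end Counting

theorem mainTheorem9 (r : ℕ) (hr : 2 ≤ r) (k : ℕ) (hk : 2 ≤ k) :
    ¬ IsKRegular k (fun n : ℕ => (baumSweetOnes r n : ℤ)) := by
  intro hreg
  obtain ⟨p, hp0, hp1, hp, hirr⟩ := exists_irrational_add_pow_eq_one (r := r) (by omega)
  have hlim := tendsto_div_of_recurrence (P := fun X => (baumSweetCount r X : ℝ)) (C := 1)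
    hp0 hp1 hp (by omega) (fun X => Nat.cast_nonneg _)
    (tendsto_natCast_atTop_atTop.comp (tendsto_baumSweetCount r)) (by
      intro X
      obtain ⟨h1, h2⟩ := baumSweetCount_recurrence (r := r) (by omega) X
      have h1' : (baumSweetCount r (X / 2) : ℝ) + baumSweetCount r (X / 2 ^ r)
        ≤ baumSweetCount r X := by exact_mod_cast h1
      have h2' : (baumSweetCount r X : ℝ) ≤ baumSweetCount r (X / 2)
        + baumSweetCount r (X / 2 ^ r) + 1 := by exact_mod_cast h2
      rw [abs_le]
      constructor <;> linarith)
  have hsub : Filter.Tendsto (fun i : ℕ => baumSweetOnes r (k ^ i)) Filter.atTop Filter.atTop :=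
    (baumSweetOnes_strictMono r).tendsto_atTop.comp
      (tendsto_pow_atTop_atTop_of_one_lt (by omega))
  -- At `X = baumSweetOnes r (k ^ i)` the count is exactly `k ^ i`, so the mean is the ratio whose
  -- limit is `p`.
  obtain ⟨q, hq⟩ := exists_rat_eq_mean_of_finite_kKernel _ hreg.finite_kKernel_odd p (by
    refine (hlim.comp hsub).congr fun i => ?_
    rw [sum_odd_baumSweetOnes]
    simp [baumSweetCount_baumSweetOnes])
  exact hirr ⟨q, hq⟩
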